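/- Let $S_1,S_2$ be compact Hausdorff spaces. For a compact Hausdorff space $S$, let $C(S,[0,1])$ be the set of all continuous functions $S\to[0,1]$, regarded as an MV-algebra under the pointwise operations $(f\oplus g)(s)=\min\{f(s)+g(s),1\}$, $(\neg f)(s)=1-f(s)$ and the constant $0$; its underlying lattice operations $f\vee g=\neg(\neg f\oplus g)\oplus g$ and $f\wedge g=\neg(\neg f\vee\neg g)$ are the pointwise maximum and minimum. An MV-subalgebra of $C(S,[0,1])$ is a subset that contains $0$ and is closed under $\oplus$ and $\neg$ (it is then also closed under $\vee$ and $\wedge$, hence a lattice). A subset $B\subseteq C(S,[0,1])$ separates the points of $S$ if for all $p\neq q$ in $S$ there is $b\in B$ with $b(p)=0$ and $b(q)>0$. (i) Let $A_i\subseteq C(S_i,[0,1])$ ($i=1,2$) be MV-subalgebras such that $A_i$ separates the points of $S_i$ for $i=1,2$. If $A_1$ and $A_2$ are isomorphic as lattices, then $S_1$ and $S_2$ are homeomorphic. (ii) The lattices $C(S_1,[0,1])$ and $C(S_2,[0,1])$ are isomorphic if and only if $S_1$ and $S_2$ are homeomorphic. -/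

import Mathlib

/-- `B ⊆ C(S, [0,1])` separates the points of `S`: for all `p ≠ q` in `S` there is `b ∈ B` with
`b p = 0` and `b q > 0`. -/
def SeparatesThePoints {S : Type*} [TopologicalSpace S] (B : Set C(S, unitInterval)) : Prop :=
  ∀ p q : S, p ≠ q → ∃ b ∈ B, b p = 0 ∧ 0 < b q

/-- An MV-algebra `(M, ⊕, ¬, 0)`: a commutative monoid `(M, ⊕, 0)` with an involutive unary
operation `¬` such that `¬0` is absorbing for `⊕` and `¬(¬x ⊕ y) ⊕ y = ¬(¬y ⊕ x) ⊕ x`. -/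
class MVAlgebra (M : Type*) extends Zero M where
  oplus : M → M → M
  neg : M → M
  oplus_assoc (x y z : M) : oplus (oplus x y) z = oplus x (oplus y z)
  oplus_comm (x y : M) : oplus x y = oplus y x
  oplus_zero (x : M) : oplus x 0 = x
  neg_neg (x : M) : neg (neg x) = x
  oplus_neg_zero (x : M) : oplus x (neg 0) = neg 0
  neg_oplus_oplus (x y : M) :
    oplus (neg (oplus (neg x) y)) y = oplus (neg (oplus (neg y) x)) x

namespace MVAlgebra

variable {M : Type*} [MVAlgebra M]

/-- The join `x ∨ y := ¬(¬x ⊕ y) ⊕ y` of the underlying lattice of an MV-algebra. -/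
def join (x y : M) : M := oplus (neg (oplus (neg x) y)) y

/-- The meet `x ∧ y := ¬(¬x ∨ ¬y)` of the underlying lattice of an MV-algebra. -/
def meet (x y : M) : M := neg (join (neg x) (neg y))

end MVAlgebra

/-- An MV-subalgebra: a subset that contains `0` and is closed under `⊕` and `¬`. -/
structure MVSubalgebra (M : Type*) [MVAlgebra M] where
  carrier : Set M
  zero_mem : (0 : M) ∈ carrier
  oplus_mem {x y : M} : x ∈ carrier → y ∈ carrier → MVAlgebra.oplus x y ∈ carrier
  neg_mem {x : M} : x ∈ carrier → MVAlgebra.neg x ∈ carrier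

/-- The standard MV-algebra `[0,1]`: `x ⊕ y = min (x + y) 1` and `¬x = 1 - x`. -/
noncomputable instance unitInterval.instMVAlgebra : MVAlgebra unitInterval where
  toZero := inferInstance
  oplus x y := ⟨min ((x : ℝ) + y) 1,
    le_min (add_nonneg x.2.1 y.2.1) zero_le_one, min_le_right _ _⟩
  neg x := unitInterval.symm x
  oplus_assoc x y z := by
    have hx := x.2.1; have hy := y.2.1; have hz := z.2.1
    apply Subtype.ext
    simp only
    grind
  oplus_comm x y := by
    apply Subtype.ext
    simp only [add_comm]
  oplus_zero x := by
    apply Subtype.ext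
    simp [x.2.2]
  neg_neg x := by simp
  oplus_neg_zero x := by
    apply Subtype.ext
    simp [x.2.1]
  neg_oplus_oplus x y := by
    have hx := x.2.1; have hy := y.2.1
    apply Subtype.ext
    simp only [unitInterval.coe_symm_eq]
    grind

/-- `C(S, [0,1])` with the pointwise operations of the standard MV-algebra `[0,1]`. -/
noncomputable instance ContinuousMap.instMVAlgebra {S : Type*} [TopologicalSpace S] :
    MVAlgebra C(S, unitInterval) where
  toZero := inferInstance
  oplus f g := ⟨fun s => MVAlgebra.oplus (f s) (g s), by
    refine Continuous.subtype_mk ?_ _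
    fun_prop⟩
  neg f := ⟨fun s => MVAlgebra.neg (f s), unitInterval.continuous_symm.comp f.continuous⟩
  oplus_assoc f g h := ContinuousMap.ext fun s => MVAlgebra.oplus_assoc (f s) (g s) (h s)
  oplus_comm f g := ContinuousMap.ext fun s => MVAlgebra.oplus_comm (f s) (g s)
  oplus_zero f := ContinuousMap.ext fun s => MVAlgebra.oplus_zero (f s)
  neg_neg f := ContinuousMap.ext fun s => MVAlgebra.neg_neg (f s)
  oplus_neg_zero f := ContinuousMap.ext fun s => MVAlgebra.oplus_neg_zero (f s)
  neg_oplus_oplus f g := ContinuousMap.ext fun s => MVAlgebra.neg_oplus_oplus (f s) (g s)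

/-- In `C(S, [0,1])` the MV-join is the pointwise maximum. -/
theorem ContinuousMap.mvJoin_eq_sup {S : Type*} [TopologicalSpace S]
    (f g : C(S, unitInterval)) : MVAlgebra.join f g = f ⊔ g := by
  refine ContinuousMap.ext fun s => Subtype.ext ?_
  have hf := (f s).2.2
  have hg := (g s).2.2
  have hf' := (f s).2.1
  have hg' := (g s).2.1
  change min ((1 - min ((1 - (f s : ℝ)) + g s) 1) + (g s : ℝ)) 1 = ((f s ⊔ g s : unitInterval) : ℝ)
  rw [show ((f s ⊔ g s : unitInterval) : ℝ) = max (f s : ℝ) (g s) from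
    Monotone.map_sup (Subtype.mono_coe _) _ _]
  grind

/-- In `C(S, [0,1])` the MV-meet is the pointwise minimum. -/
theorem ContinuousMap.mvMeet_eq_inf {S : Type*} [TopologicalSpace S]
    (f g : C(S, unitInterval)) : MVAlgebra.meet f g = f ⊓ g := by
  rw [MVAlgebra.meet, ContinuousMap.mvJoin_eq_sup]
  refine ContinuousMap.ext fun s => ?_
  change unitInterval.symm (unitInterval.symm (f s) ⊔ unitInterval.symm (g s)) = f s ⊓ g s
  rcases le_total (f s) (g s) with h | h
  · rw [sup_eq_left.2 (unitInterval.symm_le_symm.2 h), inf_eq_left.2 h, unitInterval.symm_symm]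
  · rw [sup_eq_right.2 (unitInterval.symm_le_symm.2 h), inf_eq_right.2 h, unitInterval.symm_symm]

namespace MVSubalgebra

variable {S : Type*} [TopologicalSpace S]

theorem sup_mem (A : MVSubalgebra C(S, unitInterval)) {f g : C(S, unitInterval)}
    (hf : f ∈ A.carrier) (hg : g ∈ A.carrier) : f ⊔ g ∈ A.carrier := by
  rw [← ContinuousMap.mvJoin_eq_sup]
  exact A.oplus_mem (A.neg_mem (A.oplus_mem (A.neg_mem hf) hg)) hg

theorem inf_mem (A : MVSubalgebra C(S, unitInterval)) {f g : C(S, unitInterval)}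
    (hf : f ∈ A.carrier) (hg : g ∈ A.carrier) : f ⊓ g ∈ A.carrier := by
  rw [← ContinuousMap.mvMeet_eq_inf, MVAlgebra.meet, ContinuousMap.mvJoin_eq_sup]
  exact A.neg_mem (A.sup_mem (A.neg_mem hf) (A.neg_mem hg))

/-- The underlying lattice of an MV-subalgebra of `C(S, [0,1])`. Its join and meet are the
MV-join and MV-meet, that is, the pointwise maximum and minimum. -/
instance instLattice (A : MVSubalgebra C(S, unitInterval)) : Lattice A.carrier :=
  Subtype.lattice (fun _ _ hf hg => A.sup_mem hf hg) (fun _ _ hf hg => A.inf_mem hf hg)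

end MVSubalgebra

/-- Two lattices are isomorphic: there is a bijective lattice homomorphism between them. -/
def LatticeIsomorphic (L M : Type*) [Lattice L] [Lattice M] : Prop :=
  ∃ f : LatticeHom L M, Function.Bijective f

/-! A point `x` is recovered from the lattice as the family `germOne x`. Say that `f` is well inside
`g` if some `h` is disjoint from `f` and codisjoint from `g`. Then `g = 1` wherever `f ≠ 0`, and
lattice isomorphisms preserve the relation. Every `g` in `germOne x` has such an `f` in `germOne x`
(`exists_germOne_interpolant`).

For an isomorphism `φ`, compactness gives a point `y` where all `φ g` with `g ∈ germOne x` equal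
`1`. As `φ f` is nonzero near `y`, `φ g` is `1` near `y`, so `φ` maps `germOne x` into `germOne y`.
Applying this to `φ.symm` as well gives equality, because an inclusion of germ families forces equal
points. Hence `x ↦ y` is a homeomorphism. -/

open Filter Topology in
/-- The elements of an MV-subalgebra of `C(S, [0,1])` that are constantly `1` near `x`. -/
def MVSubalgebra.germOne {S : Type*} [TopologicalSpace S]
    (A : MVSubalgebra C(S, unitInterval)) (x : S) : Set A.carrier :=
  {g | ∀ᶠ y in 𝓝 x, g.1 y = 1}

namespace MVSubalgebra

open Filter Topology

variable {S : Type*} [TopologicalSpace S] (A : MVSubalgebra C(S, unitInterval))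

theorem one_mem : (1 : C(S, unitInterval)) ∈ A.carrier := by
  have h := A.neg_mem A.zero_mem
  have e : MVAlgebra.neg (0 : C(S, unitInterval)) = 1 := by
    refine ContinuousMap.ext fun s => ?_
    exact unitInterval.symm_zero
  rwa [e] at h

instance instBoundedOrder : BoundedOrder A.carrier where
  top := ⟨1, A.one_mem⟩
  le_top _ := fun _ => unitInterval.le_one'
  bot := ⟨0, A.zero_mem⟩
  bot_le _ := fun _ => unitInterval.nonneg'

variable {A}

theorem bot_apply (s : S) : (⊥ : A.carrier).1 s = 0 := rfl

theorem top_apply (s : S) : (⊤ : A.carrier).1 s = 1 := rfl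

theorem inf_apply (f g : A.carrier) (s : S) : (f ⊓ g).1 s = f.1 s ⊓ g.1 s := rfl

theorem disjoint_iff_forall {f g : A.carrier} :
    Disjoint f g ↔ ∀ s, f.1 s = 0 ∨ g.1 s = 0 := by
  rw [disjoint_iff]
  constructor
  · intro h s
    have h1 : (f ⊓ g).1 s = 0 := by rw [h]; rfl
    rw [inf_apply] at h1
    rcases le_total (f.1 s) (g.1 s) with h2 | h2
    · left; rwa [inf_eq_left.2 h2] at h1
    · right; rwa [inf_eq_right.2 h2] at h1
  · intro h
    refine Subtype.ext (ContinuousMap.ext fun s => ?_)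
    rw [inf_apply, bot_apply]
    rcases h s with h | h <;> rw [h]
    · exact inf_eq_left.2 unitInterval.nonneg'
    · exact inf_eq_right.2 unitInterval.nonneg'

theorem codisjoint_iff_forall {f g : A.carrier} :
    Codisjoint f g ↔ ∀ s, f.1 s = 1 ∨ g.1 s = 1 := by
  have sup_apply (s : S) : (f ⊔ g).1 s = f.1 s ⊔ g.1 s := rfl
  rw [codisjoint_iff]
  constructor
  · intro h s
    have h1 : (f ⊔ g).1 s = 1 := by rw [h]; rfl
    rw [sup_apply] at h1
    rcases le_total (f.1 s) (g.1 s) with h2 | h2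
    · right; rwa [sup_eq_right.2 h2] at h1
    · left; rwa [sup_eq_left.2 h2] at h1
  · intro h
    refine Subtype.ext (ContinuousMap.ext fun s => ?_)
    rw [sup_apply, top_apply]
    rcases h s with h | h <;> rw [h]
    · exact sup_eq_left.2 unitInterval.le_one'
    · exact sup_eq_right.2 unitInterval.le_one'

/-! ### Separating functions built from the MV operations -/

theorem exists_double {f : C(S, unitInterval)} (hf : f ∈ A.carrier) :
    ∃ g ∈ A.carrier, ∀ s, (g s : ℝ) = min (f s + f s : ℝ) 1 :=
  ⟨_, A.oplus_mem hf hf, fun _ => rfl⟩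

theorem exists_compl {f : C(S, unitInterval)} (hf : f ∈ A.carrier) :
    ∃ g ∈ A.carrier, ∀ s, (g s : ℝ) = 1 - f s :=
  ⟨_, A.neg_mem hf, fun _ => rfl⟩

theorem exists_mul {f : C(S, unitInterval)} (hf : f ∈ A.carrier) (n : ℕ) :
    ∃ g ∈ A.carrier, ∀ s, (g s : ℝ) = min (n * f s : ℝ) 1 := by
  induction n with
  | zero => exact ⟨0, A.zero_mem, fun s => by simp⟩
  | succ n ih =>
    obtain ⟨g, hg, h⟩ := ih
    refine ⟨_, A.oplus_mem hg hf, fun s => ?_⟩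
    change min ((g s : ℝ) + f s) 1 = _
    rw [h]
    have := (f s).2.1
    push_cast
    grind

/-- Truncated `2 f - 1`. -/
theorem exists_sharpen {f : C(S, unitInterval)} (hf : f ∈ A.carrier) :
    ∃ g ∈ A.carrier, ∀ s, (g s : ℝ) = max (2 * f s - 1 : ℝ) 0 := by
  obtain ⟨c, hc, h1⟩ := exists_compl hf
  obtain ⟨d, hd, h2⟩ := exists_double hc
  obtain ⟨e, he, h3⟩ := exists_compl hd
  refine ⟨e, he, fun s => ?_⟩
  rw [h3, h2, h1]
  grind

theorem exists_eq_one_eventually_eq_zero (hA : SeparatesThePoints A.carrier) {p q : S}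
    (hpq : p ≠ q) : ∃ f ∈ A.carrier, f q = 1 ∧ ∀ᶠ s in 𝓝 p, f s = 0 := by
  obtain ⟨b, hb, hp, hq⟩ := hA p q hpq
  have hq' : (0 : ℝ) < b q := hq
  -- The truncated multiple `n b` is `1` at `q` and below `1/2` near `p`, where sharpening makes it
  -- vanish.
  obtain ⟨n, hn⟩ := exists_nat_ge (1 / (b q : ℝ))
  rw [div_le_iff₀ hq'] at hn
  obtain ⟨c, hc, h1⟩ := exists_mul hb n
  obtain ⟨d, hd, h2⟩ := exists_sharpen hc
  refine ⟨d, hd, ?_, ?_⟩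
  · apply Subtype.ext
    rw [h2, h1, min_eq_right hn]
    norm_num
  · have hc0 : (c p : ℝ) < 1 / 2 := by rw [h1, hp]; norm_num
    have hcont : Continuous fun s => (c s : ℝ) := by fun_prop
    filter_upwards [hcont.continuousAt.eventually (gt_mem_nhds hc0)] with s hs
    apply Subtype.ext
    rw [h2, max_eq_right (by linarith)]
    rfl

/-- The complement of `U` is compact, so a finite meet of functions, each vanishing near one of its
points, suffices. -/
theorem exists_peak [CompactSpace S] (hA : SeparatesThePoints A.carrier) {x : S} {U : Set S}
    (hU : IsOpen U) (hx : x ∈ U) :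
    ∃ k ∈ A.carrier, k x = 1 ∧ ∀ s, s ∉ U → k s = 0 := by
  change ∃ k ∈ A.carrier, k x = 1 ∧ ∀ s ∈ Uᶜ, k s = 0
  refine hU.isClosed_compl.isCompact.induction_on
    (p := fun K => ∃ k ∈ A.carrier, k x = 1 ∧ ∀ s ∈ K, k s = 0) ?_ ?_ ?_ ?_
  · exact ⟨1, A.one_mem, rfl, by simp⟩
  · rintro K L hKL ⟨k, hk, h1, h2⟩
    exact ⟨k, hk, h1, fun s hs => h2 s (hKL hs)⟩
  · rintro K L ⟨k, hk, h1, h2⟩ ⟨l, hl, h3, h4⟩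
    refine ⟨k ⊓ l, A.inf_mem hk hl, ?_, ?_⟩
    · change k x ⊓ l x = 1
      rw [h1, h3, inf_idem]
    · intro s hs
      change k s ⊓ l s = 0
      rcases hs with hs | hs
      · rw [h2 s hs]; exact inf_eq_left.2 unitInterval.nonneg'
      · rw [h4 s hs]; exact inf_eq_right.2 unitInterval.nonneg'
  · intro q hq
    have hqx : q ≠ x := by rintro rfl; exact hq hx
    obtain ⟨f, hf, h1, h2⟩ := exists_eq_one_eventually_eq_zero hA hqx
    exact ⟨{s | f s = 0}, mem_nhdsWithin_of_mem_nhds h2, f, hf, h1, fun _ h => h⟩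

/-- Some element is `1` near `x` and vanishes where another one is not `0`, the latter being
`1` off a given neighbourhood of `x`. -/
theorem exists_germOne_disjoint [CompactSpace S] (hA : SeparatesThePoints A.carrier) {x : S}
    {U : Set S} (hU : U ∈ 𝓝 x) :
    ∃ f ∈ A.germOne x, ∃ h : A.carrier, Disjoint f h ∧ ∀ s, s ∉ U → h.1 s = 1 := by
  obtain ⟨V, hVU, hV, hxV⟩ := mem_nhds_iff.1 hU
  obtain ⟨k, hk, hk1, hk0⟩ := exists_peak hA hV hxV
  -- `f` is `1` where `k ≥ 3/4` and `0` where `k ≤ 1/2`; `h = 1 - min (2k) 1` is `0` where `k ≥ 1/2`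
  -- and `1` where `k = 0`.
  obtain ⟨c, hc, h1⟩ := exists_sharpen hk
  obtain ⟨f, hf, h2⟩ := exists_double hc
  obtain ⟨d, hd, h3⟩ := exists_double hk
  obtain ⟨h, hh, h4⟩ := exists_compl hd
  refine ⟨⟨f, hf⟩, ?_, ⟨h, hh⟩, disjoint_iff_forall.2 fun s => ?_, fun s hs => ?_⟩
  · have hkx : (3 / 4 : ℝ) < k x := by rw [hk1]; norm_num
    have hcont : Continuous fun s => (k s : ℝ) := by fun_prop
    filter_upwards [hcont.continuousAt.eventually (lt_mem_nhds hkx)] with s hs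
    apply Subtype.ext
    rw [h2, h1, max_eq_left (by linarith), min_eq_right (by linarith)]
    rfl
  · rcases le_total (k s : ℝ) (1 / 2) with hs | hs
    · left
      apply Subtype.ext
      rw [h2, h1, max_eq_right (by linarith)]
      norm_num
    · right
      apply Subtype.ext
      rw [h4, h3, min_eq_right (by linarith)]
      norm_num
  · apply Subtype.ext
    rw [h4, h3, hk0 s fun h => hs (hVU h)]
    norm_num

theorem exists_germOne_eq_zero [CompactSpace S] (hA : SeparatesThePoints A.carrier) {x : S}
    {U : Set S} (hU : U ∈ 𝓝 x) : ∃ f ∈ A.germOne x, ∀ s, s ∉ U → f.1 s = 0 := by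
  obtain ⟨f, hf, h, hfh, hU⟩ := exists_germOne_disjoint hA hU
  refine ⟨f, hf, fun s hs => (disjoint_iff_forall.1 hfh s).resolve_right ?_⟩
  rw [hU s hs]
  exact one_ne_zero

theorem exists_germOne_interpolant [CompactSpace S] (hA : SeparatesThePoints A.carrier) {x : S}
    {g : A.carrier} (hg : g ∈ A.germOne x) :
    ∃ f ∈ A.germOne x, ∃ h : A.carrier, Disjoint f h ∧ Codisjoint h g := by
  obtain ⟨f, hf, h, hfh, hU⟩ := exists_germOne_disjoint hA hg
  refine ⟨f, hf, h, hfh, codisjoint_iff_forall.2 fun s => ?_⟩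
  by_cases hs : g.1 s = 1
  · exact Or.inr hs
  · exact Or.inl (hU s hs)

theorem eq_one_of_disjoint_codisjoint {f g h : A.carrier} (hfh : Disjoint f h)
    (hhg : Codisjoint h g) {s : S} (hs : f.1 s ≠ 0) : g.1 s = 1 := by
  refine (codisjoint_iff_forall.1 hhg s).resolve_left ?_
  rw [(disjoint_iff_forall.1 hfh s).resolve_left hs]
  exact zero_ne_one

theorem apply_eq_one_of_mem_germOne {x : S} {g : A.carrier} (hg : g ∈ A.germOne x) :
    g.1 x = 1 :=
  hg.self_of_nhds

theorem eq_of_germOne_subset [CompactSpace S] [T2Space S] (hA : SeparatesThePoints A.carrier)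
    {x y : S} (h : A.germOne x ⊆ A.germOne y) : x = y := by
  by_contra hxy
  obtain ⟨f, hf, h0⟩ := exists_germOne_eq_zero hA (isOpen_compl_singleton.mem_nhds
    (show x ∈ ({y} : Set S)ᶜ from hxy))
  have h1 := apply_eq_one_of_mem_germOne (h hf)
  rw [h0 y (by simp)] at h1
  exact zero_ne_one h1

theorem isOpen_setOf_mem_germOne (g : A.carrier) : IsOpen {x | g ∈ A.germOne x} :=
  isOpen_setOfPred_eventually_nhds

/-! ### Transport of germs along an order isomorphism -/

section OrderIso

variable {T : Type*} [TopologicalSpace T] [CompactSpace S] [CompactSpace T]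
  {B : MVSubalgebra C(T, unitInterval)}

theorem exists_germOne_subset_preimage (hA : SeparatesThePoints A.carrier)
    (φ : A.carrier ≃o B.carrier) (x : S) : ∃ y : T, A.germOne x ⊆ φ ⁻¹' B.germOne y := by
  have transfer {f g : A.carrier} {h : A.carrier} (hfh : Disjoint f h) (hhg : Codisjoint h g)
      {t : T} (ht : (φ f).1 t ≠ 0) : (φ g).1 t = 1 :=
    eq_one_of_disjoint_codisjoint ((disjoint_map_orderIso_iff φ).2 hfh)
      ((codisjoint_map_orderIso_iff φ).2 hhg) ht
  have : Nonempty (A.germOne x) := ⟨⊤, Eventually.of_forall top_apply⟩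
  have hne : (⋂ g : A.germOne x, {t | (φ g).1 t = 1}).Nonempty := by
    refine IsCompact.nonempty_iInter_of_directed_nonempty_isCompact_isClosed _ ?_ ?_ ?_ ?_
    · rintro ⟨f, hf⟩ ⟨g, hg⟩
      refine ⟨⟨f ⊓ g, ?_⟩, ?_, ?_⟩
      · filter_upwards [hf, hg] with s h1 h2
        rw [inf_apply, h1, h2, inf_idem]
      · intro t ht
        have hle : (φ (f ⊓ g)).1 t ≤ (φ f).1 t := φ.monotone inf_le_left t
        exact le_antisymm unitInterval.le_one' (ht.symm.le.trans hle)
      · intro t ht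
        have hle : (φ (f ⊓ g)).1 t ≤ (φ g).1 t := φ.monotone inf_le_right t
        exact le_antisymm unitInterval.le_one' (ht.symm.le.trans hle)
    -- Since `f ≠ ⊥`, `φ f` is nonzero at some point, and there `φ g = 1`.
    · rintro ⟨g, hg⟩
      obtain ⟨f, hf, h, hfh, hhg⟩ := exists_germOne_interpolant hA hg
      by_contra hempty
      have hbot : φ f = ⊥ := by
        refine Subtype.ext (ContinuousMap.ext fun t => ?_)
        by_contra ht
        exact hempty ⟨t, transfer hfh hhg ht⟩
      have hf0 : f = ⊥ := (map_eq_bot_iff φ).1 hbot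
      have h1 := apply_eq_one_of_mem_germOne hf
      rw [hf0, bot_apply] at h1
      exact zero_ne_one h1
    · intro g
      exact (isClosed_eq (φ g).1.continuous continuous_const).isCompact
    · intro g
      exact isClosed_eq (φ g).1.continuous continuous_const
  obtain ⟨y, hy⟩ := hne
  rw [Set.mem_iInter] at hy
  refine ⟨y, fun g hg => ?_⟩
  obtain ⟨f, hf, h, hfh, hhg⟩ := exists_germOne_interpolant hA hg
  have hfy : (φ f).1 y ≠ 0 := by
    rw [show (φ f).1 y = 1 from hy ⟨f, hf⟩]
    exact one_ne_zero
  filter_upwards [(φ f).1.continuous.continuousAt.eventually_ne hfy] with t ht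
  exact transfer hfh hhg ht

theorem exists_germOne_eq_preimage [T2Space S] (hA : SeparatesThePoints A.carrier)
    (hB : SeparatesThePoints B.carrier) (φ : A.carrier ≃o B.carrier) (x : S) :
    ∃ y : T, ∀ g, g ∈ A.germOne x ↔ φ g ∈ B.germOne y := by
  obtain ⟨y, hy⟩ := exists_germOne_subset_preimage hA φ x
  obtain ⟨z, hz⟩ := exists_germOne_subset_preimage hB φ.symm y
  have hyz {g : A.carrier} (hg : φ g ∈ B.germOne y) : g ∈ A.germOne z := by
    have := hz hg
    rwa [Set.mem_preimage, φ.symm_apply_apply] at this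
  obtain rfl : x = z := eq_of_germOne_subset hA fun g hg => hyz (hy hg)
  exact ⟨y, fun g => ⟨fun h => hy h, hyz⟩⟩

theorem continuous_of_germOne_iff (hB : SeparatesThePoints B.carrier)
    (φ : A.carrier ≃o B.carrier) {τ : S → T}
    (hτ : ∀ x g, g ∈ A.germOne x ↔ φ g ∈ B.germOne (τ x)) : Continuous τ := by
  refine continuous_iff_continuousAt.2 fun x U hU => ?_
  obtain ⟨g, hg, h0⟩ := exists_germOne_eq_zero hB hU
  have hx : φ.symm g ∈ A.germOne x := by rwa [hτ, φ.apply_symm_apply]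
  rw [Filter.mem_map]
  -- For `z` near `x`, `g` is `1` at `τ z`; as `g` vanishes off `U`, `τ z ∈ U`.
  filter_upwards [(isOpen_setOf_mem_germOne (φ.symm g)).mem_nhds hx] with z hz
  rw [hτ, φ.apply_symm_apply] at hz
  by_contra hzU
  have h1 := apply_eq_one_of_mem_germOne hz
  rw [h0 _ hzU] at h1
  exact zero_ne_one h1

theorem nonempty_homeomorph_of_orderIso [T2Space S] [T2Space T]
    (hA : SeparatesThePoints A.carrier)
    (hB : SeparatesThePoints B.carrier) (φ : A.carrier ≃o B.carrier) : Nonempty (S ≃ₜ T) := by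
  choose τ hτ using exists_germOne_eq_preimage hA hB φ
  choose σ hσ using exists_germOne_eq_preimage hB hA φ.symm
  refine ⟨⟨⟨τ, σ, fun x => ?_, fun y => ?_⟩, continuous_of_germOne_iff hB φ hτ,
    continuous_of_germOne_iff hA φ.symm hσ⟩⟩
  · refine (eq_of_germOne_subset hA fun g hg => ?_).symm
    rwa [hτ, hσ, φ.symm_apply_apply] at hg
  · refine (eq_of_germOne_subset hB fun g hg => ?_).symm
    rwa [hσ, hτ, φ.apply_symm_apply] at hg

end OrderIso

end MVSubalgebra

/-! ### The full algebra of continuous functions -/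

theorem LatticeIsomorphic.nonempty_orderIso {L M : Type*} [Lattice L] [Lattice M]
    (h : LatticeIsomorphic L M) : Nonempty (L ≃o M) := by
  obtain ⟨f, hf⟩ := h
  refine ⟨⟨Equiv.ofBijective f hf, fun {a b} => ?_⟩⟩
  change f a ≤ f b ↔ a ≤ b
  rw [← inf_eq_left, ← map_inf, hf.1.eq_iff, inf_eq_left]

/-- `C(S, [0,1])` as an MV-subalgebra of itself. -/
def MVSubalgebra.full (S : Type*) [TopologicalSpace S] : MVSubalgebra C(S, unitInterval) where
  carrier := Set.univ
  zero_mem := trivial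
  oplus_mem _ _ := trivial
  neg_mem _ := trivial

/-- The full MV-subalgebra is order isomorphic to `C(S, [0,1])`. -/
def MVSubalgebra.fullOrderIso (S : Type*) [TopologicalSpace S] :
    (MVSubalgebra.full S).carrier ≃o C(S, unitInterval) where
  toEquiv := Equiv.Set.univ _
  map_rel_iff' := Iff.rfl

theorem MVSubalgebra.separatesThePoints_full (S : Type*) [TopologicalSpace S] [CompactSpace S]
    [T2Space S] : SeparatesThePoints (MVSubalgebra.full S).carrier := by
  intro p q hpq
  obtain ⟨f, h0, h1, h01⟩ := exists_continuous_zero_one_of_isClosed (isClosed_singleton (x := p))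
    (isClosed_singleton (x := q)) (Set.disjoint_singleton.2 hpq)
  refine ⟨⟨fun s => ⟨f s, h01 s⟩, f.continuous.subtype_mk _⟩, trivial, ?_, ?_⟩
  · exact Subtype.ext (h0 rfl)
  · change (0 : ℝ) < f q
    rw [h1 rfl]
    exact one_pos

theorem latticeIsomorphic_of_homeomorph {S T : Type*} [TopologicalSpace S] [TopologicalSpace T]
    (e : S ≃ₜ T) : LatticeIsomorphic C(S, unitInterval) C(T, unitInterval) := by
  refine ⟨⟨⟨fun f => f.comp (e.symm : C(T, S)), fun f g => rfl⟩, fun f g => rfl⟩, ?_, ?_⟩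
  · intro f g h
    refine ContinuousMap.ext fun s => ?_
    have := DFunLike.congr_fun h (e s)
    change f (e.symm (e s)) = g (e.symm (e s)) at this
    rwa [e.symm_apply_apply] at this
  · intro g
    refine ⟨g.comp (e : C(S, T)), ContinuousMap.ext fun t => ?_⟩
    change g (e (e.symm t)) = g t
    rw [e.apply_symm_apply]

theorem corollary7p8 {S₁ S₂ : Type*}
    [TopologicalSpace S₁] [CompactSpace S₁] [T2Space S₁]
    [TopologicalSpace S₂] [CompactSpace S₂] [T2Space S₂] :
    (∀ (A₁ : MVSubalgebra C(S₁, unitInterval)) (A₂ : MVSubalgebra C(S₂, unitInterval)),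
      SeparatesThePoints A₁.carrier → SeparatesThePoints A₂.carrier →
      LatticeIsomorphic A₁.carrier A₂.carrier → Nonempty (S₁ ≃ₜ S₂)) ∧
    (LatticeIsomorphic C(S₁, unitInterval) C(S₂, unitInterval) ↔ Nonempty (S₁ ≃ₜ S₂)) := by
  refine ⟨fun A₁ A₂ h₁ h₂ h => ?_, fun h => ?_, fun ⟨e⟩ => latticeIsomorphic_of_homeomorph e⟩
  · obtain ⟨φ⟩ := h.nonempty_orderIso
    exact MVSubalgebra.nonempty_homeomorph_of_orderIso h₁ h₂ φ
  · obtain ⟨φ⟩ := h.nonempty_orderIso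
    exact MVSubalgebra.nonempty_homeomorph_of_orderIso
      (MVSubalgebra.separatesThePoints_full S₁) (MVSubalgebra.separatesThePoints_full S₂)
      (((MVSubalgebra.fullOrderIso S₁).trans φ).trans (MVSubalgebra.fullOrderIso S₂).symm)
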